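/- For a Banach algebra $B$ (not necessarily unital or commutative) let $M_B$ denote its maximal ideal space, that is, the set of nonzero (continuous) multiplicative linear functionals $B\to\mathbb{C}$ with the weak-$*$ topology. Let $A$ be an operator algebra, that is, a norm-closed, not necessarily unital, subalgebra of $B(H)$ for a complex Hilbert space $H$, and let $C^*_m(A)$ be its maximal $C^*$-algebra, that is, the $C^*$-algebra generated by the image of $A$ under the direct sum of all completely contractive representations of $A$ on Hilbert spaces. Then $M_{C^*_m(A)}$ is homeomorphic to $M_A$. Moreover, let $Q$ be a directed graph with range and source maps $r,s$. A contractive representation of $Q$ on a Hilbert space $K$ assigns to each vertex $v$ an orthogonal projection $P_v\in B(K)$ (projections of different vertices need not be orthogonal to each other) and to each edge $e$ a contraction $T_e\in B(K)$ such that $P_{r(e)}T_e=T_e=T_eP_{s(e)}$. Let $OA(Q)$ and $GC^*_m(Q)$ be the norm-closed algebra and the $C^*$-algebra, respectively, generated by the vertices and edges in the direct sum of all contractive representations of $Q$ (the universal operator algebra and the universal $C^*$-algebra of $Q$). Then $M_{GC^*_m(Q)}$ is homeomorphic to $M_{OA(Q)}$. -/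

import Mathlib

open scoped ENNReal

universe u v

noncomputable section

/-! ### Operator algebras and completely contractive representations -/

/-- The bounded operator on the Hilbert space `Hⁿ = H ⊕ ⋯ ⊕ H` given by an `n × n` matrix of
bounded operators on `H`:  `(T ξ) i = ∑ j, T i j (ξ j)`. Its operator norm is the norm of `T` in
`Mₙ(B(H))`. -/
def matrixOp {H : Type*} [NormedAddCommGroup H] [InnerProductSpace ℂ H] {n : ℕ}
    (T : Matrix (Fin n) (Fin n) (H →L[ℂ] H)) :
    PiLp 2 (fun _ : Fin n => H) →L[ℂ] PiLp 2 (fun _ : Fin n => H) :=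
  ((PiLp.continuousLinearEquiv 2 ℂ (fun _ : Fin n => H)).symm :
      (∀ _ : Fin n, H) →L[ℂ] PiLp 2 (fun _ : Fin n => H)).comp
    (ContinuousLinearMap.pi fun i =>
      ∑ j, (T i j).comp (PiLp.proj 2 (fun _ : Fin n => H) j))

theorem matrixOp_apply {H : Type*} [NormedAddCommGroup H] [InnerProductSpace ℂ H] {n : ℕ}
    (T : Matrix (Fin n) (Fin n) (H →L[ℂ] H)) (ξ : PiLp 2 (fun _ : Fin n => H)) (i : Fin n) :
    matrixOp T ξ i = ∑ j, T i j (ξ j) := by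
  simp [matrixOp]

theorem norm_matrixOp_one {H : Type*} [NormedAddCommGroup H] [InnerProductSpace ℂ H]
    (T : Matrix (Fin 1) (Fin 1) (H →L[ℂ] H)) : ‖matrixOp T‖ = ‖T 0 0‖ := by
  apply le_antisymm
  · refine ContinuousLinearMap.opNorm_le_bound _ (norm_nonneg _) fun ξ => ?_
    simpa [PiLp.norm_eq_of_L2, matrixOp_apply] using (T 0 0).le_opNorm (ξ 0)
  · refine ContinuousLinearMap.opNorm_le_bound _ (norm_nonneg (matrixOp T)) fun x => ?_
    have h := (matrixOp T).le_opNorm (WithLp.toLp 2 fun _ => x)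
    simpa [PiLp.norm_eq_of_L2, matrixOp_apply] using h

/-- Let `A` be an algebra of operators on `H`, with the matrix norms inherited from `Mₙ(B(H))`.
A homomorphism `π : A → B(K)` is completely contractive if each of its amplifications
`Mₙ(A) → Mₙ(B(K))` is contractive. -/
def CompletelyContractive {H K : Type*} [NormedAddCommGroup H] [InnerProductSpace ℂ H]
    [NormedAddCommGroup K] [InnerProductSpace ℂ K] {A : NonUnitalSubalgebra ℂ (H →L[ℂ] H)}
    (π : A →ₙₐ[ℂ] (K →L[ℂ] K)) : Prop :=
  ∀ (n : ℕ) (M : Matrix (Fin n) (Fin n) A),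
    ‖matrixOp (M.map fun a => π a)‖ ≤ ‖matrixOp (M.map fun a => (a : H →L[ℂ] H))‖

theorem CompletelyContractive.norm_le {H K : Type*} [NormedAddCommGroup H]
    [InnerProductSpace ℂ H] [NormedAddCommGroup K] [InnerProductSpace ℂ K]
    {A : NonUnitalSubalgebra ℂ (H →L[ℂ] H)} {π : A →ₙₐ[ℂ] (K →L[ℂ] K)}
    (hπ : CompletelyContractive π) (a : A) : ‖π a‖ ≤ ‖(a : H →L[ℂ] H)‖ := by
  have h := hπ 1 fun _ _ => a
  rw [norm_matrixOp_one, norm_matrixOp_one] at h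
  exact h

/-- The completely contractive representations of an operator algebra on Hilbert spaces. -/
structure CCRep {H : Type u} [NormedAddCommGroup H] [InnerProductSpace ℂ H]
    (A : NonUnitalSubalgebra ℂ (H →L[ℂ] H)) : Type (u + 1) where
  /-- the Hilbert space -/
  K : Type u
  [normed : NormedAddCommGroup K]
  [inner : InnerProductSpace ℂ K]
  [complete : CompleteSpace K]
  /-- the representation -/
  π : A →ₙₐ[ℂ] (K →L[ℂ] K)
  completelyContractive : CompletelyContractive π

attribute [instance] CCRep.normed CCRep.inner CCRep.complete

/-! ### Bounded families of operators -/

/-- The C*-algebra `∏ B(K i)` of bounded families of operators, with the supremum norm and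
pointwise operations (that is, the block diagonal operators on the Hilbert space `⨁ K i`). -/
def BoundedFamily {ι : Type*} (K : ι → Type*) [∀ i, NormedAddCommGroup (K i)]
    [∀ i, InnerProductSpace ℂ (K i)] : Type _ :=
  lp (fun i => (K i →L[ℂ] K i)) ∞

instance {ι : Type*} (K : ι → Type*) [∀ i, NormedAddCommGroup (K i)]
    [∀ i, InnerProductSpace ℂ (K i)] [∀ i, CompleteSpace (K i)] :
    NonUnitalCStarAlgebra (BoundedFamily K) :=
  inferInstanceAs (NonUnitalCStarAlgebra (lp (fun i => (K i →L[ℂ] K i)) ∞))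

/-- The bounded family with given entries and a given bound. -/
def BoundedFamily.mk {ι : Type*} {K : ι → Type*} [∀ i, NormedAddCommGroup (K i)]
    [∀ i, InnerProductSpace ℂ (K i)] (T : ∀ i, K i →L[ℂ] K i) (C : ℝ) (hT : ∀ i, ‖T i‖ ≤ C) :
    BoundedFamily K :=
  ⟨T, memℓp_infty ⟨C, by rintro _ ⟨i, rfl⟩; exact hT i⟩⟩

/-! ### The maximal C*-algebra of an operator algebra -/

/-- The direct sum of all completely contractive representations of `A`: it sends `a` to the
bounded family `(π a)`, indexed by all completely contractive representations `π`. -/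
def ccEmbedding {H : Type u} [NormedAddCommGroup H] [InnerProductSpace ℂ H]
    (A : NonUnitalSubalgebra ℂ (H →L[ℂ] H)) (a : A) : BoundedFamily (CCRep.K (A := A)) :=
  BoundedFamily.mk (fun ρ => ρ.π a) ‖(a : H →L[ℂ] H)‖ fun ρ => ρ.completelyContractive.norm_le a

/-- The maximal C*-algebra `C*ₘ(A)` of an operator algebra `A`: the C*-algebra generated by the
image of `A` under the direct sum of all its completely contractive representations. -/
def maximalCStar {H : Type u} [NormedAddCommGroup H] [InnerProductSpace ℂ H]
    (A : NonUnitalSubalgebra ℂ (H →L[ℂ] H)) :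
    NonUnitalStarSubalgebra ℂ (BoundedFamily (CCRep.K (A := A))) :=
  (NonUnitalStarAlgebra.adjoin ℂ (Set.range (ccEmbedding A))).topologicalClosure

/-! ### The universal operator algebra and C*-algebra of a directed graph -/

/-- The contractive representations of a directed graph on Hilbert spaces: vertices go to
(orthogonal, but not necessarily mutually orthogonal) projections, edges go to contractions, and
the relations `r(e) e = e = e s(e)` hold. An edge `e : a ⟶ b` has source `a` and range `b`. -/
structure GraphRep (V : Type u) [Quiver.{v} V] : Type (max u v + 1) where
  /-- the Hilbert space -/
  K : Type (max u v)
  [normed : NormedAddCommGroup K]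
  [inner : InnerProductSpace ℂ K]
  [complete : CompleteSpace K]
  /-- the projections of the vertices -/
  P : V → (K →L[ℂ] K)
  /-- the contractions of the edges -/
  T : ∀ {a b : V}, (a ⟶ b) → (K →L[ℂ] K)
  isStarProjection : ∀ a, IsStarProjection (P a)
  norm_le_one : ∀ {a b : V} (e : a ⟶ b), ‖T e‖ ≤ 1
  range_mul : ∀ {a b : V} (e : a ⟶ b), P b * T e = T e
  mul_source : ∀ {a b : V} (e : a ⟶ b), T e * P a = T e

attribute [instance] GraphRep.normed GraphRep.inner GraphRep.complete

/-- The C*-algebra of bounded families of operators on the spaces of all contractive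
representations of the graph. -/
abbrev GraphProduct (V : Type u) [Quiver.{v} V] : Type (max u v + 1) :=
  BoundedFamily (GraphRep.K : GraphRep.{u, v} V → Type (max u v))

/-- The projection of a vertex in the direct sum of all contractive representations. -/
def vertexElement {V : Type u} [Quiver.{v} V] (a : V) : GraphProduct.{u, v} V :=
  BoundedFamily.mk (fun ρ => ρ.P a) 1 fun ρ => (ρ.isStarProjection a).norm_le

/-- The contraction of an edge in the direct sum of all contractive representations. -/
def edgeElement {V : Type u} [Quiver.{v} V] {a b : V} (e : a ⟶ b) : GraphProduct.{u, v} V :=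
  BoundedFamily.mk (fun ρ => ρ.T e) 1 fun ρ => ρ.norm_le_one e

/-- The generators: all vertices and all edges. -/
def graphGenerators (V : Type u) [Quiver.{v} V] : Set (GraphProduct.{u, v} V) :=
  {x | (∃ a : V, x = vertexElement a) ∨ ∃ (a b : V) (e : a ⟶ b), x = edgeElement e}

/-- The universal operator algebra `OA(Q)` of a directed graph: the closed algebra generated by
the vertices and edges in the direct sum of all contractive representations. -/
def graphOA (V : Type u) [Quiver.{v} V] : NonUnitalSubalgebra ℂ (GraphProduct.{u, v} V) :=
  (NonUnitalAlgebra.adjoin ℂ (graphGenerators.{u, v} V)).topologicalClosure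

/-- The universal C*-algebra `GC*ₘ(Q)` of a directed graph: the C*-algebra generated by
the vertices and edges in the direct sum of all contractive representations. -/
def graphCStar (V : Type u) [Quiver.{v} V] :
    NonUnitalStarSubalgebra ℂ (GraphProduct.{u, v} V) :=
  (NonUnitalStarAlgebra.adjoin ℂ (graphGenerators.{u, v} V)).topologicalClosure

/-- The maximal ideal space `M_A` of a (not necessarily unital or commutative) Banach algebra:
the nonzero multiplicative linear functionals on `A` with the weak-* topology. -/
abbrev MaximalIdealSpace (A : Type*) [NonUnitalNonAssocSemiring A] [TopologicalSpace A]
    [Module ℂ A] : Type _ :=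
  WeakDual.characterSpace ℂ A

end

/-! The homeomorphism is restriction of characters. A character of a C*-algebra is self-adjoint, so
on the C*-algebra generated by `G` it is determined by its values on `G`, and it cannot vanish on
all of `G`; hence restriction is well defined and injective. For surjectivity, a character of the
smaller algebra is itself a one-dimensional representation of the kind summed over, so it occurs as
one coordinate of the direct sum, and evaluating that coordinate extends it. The inverse is weak-*
continuous because characters are contractive: continuity on `G` passes to the generated star
algebra and then, by uniform limits, to its closure. `nonempty_homeomorph_characterSpace` packages
this. What depends on the case is that a character gives an admissible representation: for operator
algebras this is `completelyContractive_scalarRep`, for graphs `GraphRep.ofCharacter`. -/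

open WeakDual

noncomputable section

/-! ### Characters -/

/-- A continuous multiplicative functional on a normed algebra is contractive. -/
theorem norm_character_apply_le {A : Type*} [NonUnitalNormedRing A] [NormedSpace ℂ A]
    (φ : characterSpace ℂ A) (a : A) : ‖φ a‖ ≤ ‖a‖ := by
  set f : A →L[ℂ] ℂ := CharacterSpace.toCLM φ with hf
  -- Since f(x)² = f(x²), one gets |f(x)|² ≤ ‖f‖ ‖x‖², that is ‖f‖² ≤ ‖f‖; no unit is needed.
  have hle : ‖f‖ ≤ √‖f‖ := by
    refine f.opNorm_le_bound (Real.sqrt_nonneg _) fun x => ?_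
    have h : ‖f x‖ ^ 2 ≤ ‖f‖ * ‖x‖ ^ 2 := by
      calc ‖f x‖ ^ 2 = ‖f (x * x)‖ := by
            rw [hf, CharacterSpace.coe_toCLM, map_mul, norm_mul, sq]
        _ ≤ ‖f‖ * ‖x * x‖ := f.le_opNorm _
        _ ≤ ‖f‖ * ‖x‖ ^ 2 := by
            rw [sq]
            exact mul_le_mul_of_nonneg_left (norm_mul_le x x) (norm_nonneg f)
    refine le_of_sq_le_sq ?_ (by positivity)
    rwa [mul_pow, Real.sq_sqrt (norm_nonneg f)]
  have h1 : ‖f‖ ≤ 1 := by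
    have := Real.sq_sqrt (norm_nonneg f)
    have := Real.sqrt_nonneg ‖f‖
    nlinarith
  calc ‖φ a‖ = ‖f a‖ := rfl
    _ ≤ 1 * ‖a‖ := f.le_of_opNorm_le h1 a
    _ = ‖a‖ := one_mul _

theorem norm_character_subalgebra_apply_le {B : Type*} [NonUnitalNormedRing B]
    [NormedSpace ℂ B] {S : NonUnitalSubalgebra ℂ B} (φ : characterSpace ℂ S) (a : S) :
    ‖φ a‖ ≤ ‖a‖ :=
  letI : NormedSpace ℂ S := inferInstanceAs (NormedSpace ℂ S.toSubmodule)
  norm_character_apply_le φ a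

/-- Characters of a (not necessarily unital) C*-algebra are self-adjoint. -/
theorem character_star {C : Type*} [NonUnitalCStarAlgebra C] (φ : characterSpace ℂ C) (x : C) :
    φ (star x) = star (φ x) := by
  -- The unitization is a unital C*-algebra, and characters of those preserve the star.
  have h := map_star (Unitization.lift (CharacterSpace.toNonUnitalAlgHom φ)) (x : Unitization ℂ C)
  rw [← Unitization.inr_star] at h
  simpa using h

/-- The character given by a continuous multiplicative functional that is nonzero somewhere. -/
def characterOf {A : Type*} [NonUnitalNonAssocSemiring A] [TopologicalSpace A] [Module ℂ A]
    (f : A →ₙₐ[ℂ] ℂ) (hf : Continuous f) (a : A) (ha : f a ≠ 0) : characterSpace ℂ A :=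
  ⟨(⟨(f : A →ₗ[ℂ] ℂ), hf⟩ : A →L[ℂ] ℂ), fun h => ha (DFunLike.congr_fun h a), map_mul f⟩

theorem exists_character_ne_zero {A : Type*} [NonUnitalNonAssocSemiring A] [TopologicalSpace A]
    [Module ℂ A] (φ : characterSpace ℂ A) : ∃ a, φ a ≠ 0 := by
  by_contra! h
  exact φ.2.1 (DFunLike.ext _ _ h)

theorem continuous_character_apply {A : Type*} [NonUnitalNonAssocSemiring A] [TopologicalSpace A]
    [Module ℂ A] (a : A) : Continuous fun φ : characterSpace ℂ A => φ a :=
  (WeakDual.eval_continuous a).comp continuous_subtype_val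

theorem continuous_into_characterSpace {X A : Type*} [TopologicalSpace X]
    [NonUnitalNonAssocSemiring A] [TopologicalSpace A] [Module ℂ A] {f : X → characterSpace ℂ A}
    (hf : ∀ a, Continuous fun x => f x a) : Continuous f :=
  (WeakDual.continuous_of_continuous_eval hf).subtype_mk _

/-! ### Restriction of characters to a generating subalgebra -/

section Generators

variable {B : Type*} [NonUnitalCStarAlgebra B]

theorem closure_starAdjoin_induction {G : Set B}
    {p : (NonUnitalStarAlgebra.adjoin ℂ G).topologicalClosure → Prop}
    (mem : ∀ (x : (NonUnitalStarAlgebra.adjoin ℂ G).topologicalClosure), (x : B) ∈ G → p x)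
    (add : ∀ x y, p x → p y → p (x + y)) (zero : p 0)
    (mul : ∀ x y, p x → p y → p (x * y)) (smul : ∀ (c : ℂ) x, p x → p (c • x))
    (star : ∀ x, p x → p (star x)) (closed : IsClosed {x | p x})
    (x : (NonUnitalStarAlgebra.adjoin ℂ G).topologicalClosure) : p x := by
  have hle := (NonUnitalStarAlgebra.adjoin ℂ G).le_topologicalClosure
  have key : ∀ (y : B) (hy : y ∈ NonUnitalStarAlgebra.adjoin ℂ G), p ⟨y, hle hy⟩ := by
    intro y hy
    induction hy using NonUnitalStarAlgebra.adjoin_induction with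
    | mem y hy => exact mem _ hy
    | add y z _ _ h₁ h₂ => exact add _ _ h₁ h₂
    | zero => exact zero
    | mul y z _ _ h₁ h₂ => exact mul _ _ h₁ h₂
    | smul c y _ h => exact smul c _ h
    | star y _ h => exact star _ h
  have hd : Dense {y : (NonUnitalStarAlgebra.adjoin ℂ G).topologicalClosure |
      (y : B) ∈ NonUnitalStarAlgebra.adjoin ℂ G} := by
    refine Subtype.dense_iff.2 fun y hy => closure_mono ?_ hy
    exact fun z hz => ⟨⟨z, hle hz⟩, hz, rfl⟩
  exact closed.closure_subset_iff.2 (fun y hy => key y hy) (hd x)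

theorem closure_adjoin_induction {G : Set B}
    {p : (NonUnitalAlgebra.adjoin ℂ G).topologicalClosure → Prop}
    (mem : ∀ (x : (NonUnitalAlgebra.adjoin ℂ G).topologicalClosure), (x : B) ∈ G → p x)
    (add : ∀ x y, p x → p y → p (x + y)) (zero : p 0)
    (mul : ∀ x y, p x → p y → p (x * y)) (smul : ∀ (c : ℂ) x, p x → p (c • x))
    (closed : IsClosed {x | p x})
    (x : (NonUnitalAlgebra.adjoin ℂ G).topologicalClosure) : p x := by
  have hle := (NonUnitalAlgebra.adjoin ℂ G).le_topologicalClosure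
  have key : ∀ (y : B) (hy : y ∈ NonUnitalAlgebra.adjoin ℂ G), p ⟨y, hle hy⟩ := by
    intro y hy
    induction hy using NonUnitalAlgebra.adjoin_induction with
    | mem y hy => exact mem _ hy
    | add y z _ _ h₁ h₂ => exact add _ _ h₁ h₂
    | zero => exact zero
    | mul y z _ _ h₁ h₂ => exact mul _ _ h₁ h₂
    | smul c y _ h => exact smul c _ h
  have hd : Dense {y : (NonUnitalAlgebra.adjoin ℂ G).topologicalClosure |
      (y : B) ∈ NonUnitalAlgebra.adjoin ℂ G} := by
    refine Subtype.dense_iff.2 fun y hy => closure_mono ?_ hy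
    exact fun z hz => ⟨⟨z, hle hz⟩, hz, rfl⟩
  exact closed.closure_subset_iff.2 (fun y hy => key y hy) (hd x)

variable {G : Set B}

/-- Closedness makes the generated subalgebra a C*-algebra in its own right. -/
theorem character_starAdjoin_star
    (ψ : characterSpace ℂ (NonUnitalStarAlgebra.adjoin ℂ G).topologicalClosure)
    (x : (NonUnitalStarAlgebra.adjoin ℂ G).topologicalClosure) : ψ (star x) = star (ψ x) :=
  haveI := NonUnitalStarSubalgebra.isClosed_topologicalClosure (NonUnitalStarAlgebra.adjoin ℂ G)
  character_star ψ x

/-- Injectivity of restriction: self-adjointness lets agreement pass to adjoints of generators. -/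
theorem character_starAdjoin_ext
    {ψ₁ ψ₂ : characterSpace ℂ (NonUnitalStarAlgebra.adjoin ℂ G).topologicalClosure}
    (h : ∀ (x : (NonUnitalStarAlgebra.adjoin ℂ G).topologicalClosure), (x : B) ∈ G → ψ₁ x = ψ₂ x) : ψ₁ = ψ₂ := by
  refine CharacterSpace.ext fun x => ?_
  refine closure_starAdjoin_induction (p := fun x => ψ₁ x = ψ₂ x) h ?_ ?_ ?_ ?_ ?_ ?_ x
  · intro x y hx hy
    rw [map_add, map_add, hx, hy]
  · rw [map_zero, map_zero]
  · intro x y hx hy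
    rw [map_mul, map_mul, hx, hy]
  · intro c x hx
    rw [map_smul, map_smul, hx]
  · intro x hx
    rw [character_starAdjoin_star, character_starAdjoin_star, hx]
  · exact isClosed_eq (map_continuous ψ₁) (map_continuous ψ₂)

/-- Ensures that the restriction of a character to the generators is not the excluded zero
functional. -/
theorem exists_mem_character_ne_zero
    (ψ : characterSpace ℂ (NonUnitalStarAlgebra.adjoin ℂ G).topologicalClosure) :
    ∃ x : (NonUnitalStarAlgebra.adjoin ℂ G).topologicalClosure, (x : B) ∈ G ∧ ψ x ≠ 0 := by
  by_contra! h
  obtain ⟨x, hx⟩ := exists_character_ne_zero ψ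
  refine hx (closure_starAdjoin_induction (p := fun x => ψ x = 0) h ?_ ?_ ?_ ?_ ?_ ?_ x)
  · intro x y hx hy
    rw [map_add, hx, hy, add_zero]
  · rw [map_zero]
  · intro x y hx hy
    rw [map_mul, hx, zero_mul]
  · intro c x hx
    rw [map_smul, hx, smul_zero]
  · intro x hx
    rw [character_starAdjoin_star, hx, star_zero]
  · exact isClosed_eq (map_continuous ψ) continuous_const

/-- A family of characters of a generated C*-algebra is weak-* continuous if it is so on the
generators. -/
theorem continuous_into_characterSpace_starAdjoin {X : Type*} [TopologicalSpace X]
    {f : X → characterSpace ℂ (NonUnitalStarAlgebra.adjoin ℂ G).topologicalClosure}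
    (hf : ∀ (x : (NonUnitalStarAlgebra.adjoin ℂ G).topologicalClosure), (x : B) ∈ G →
      Continuous fun t => f t x) : Continuous f := by
  refine continuous_into_characterSpace fun x => ?_
  refine closure_starAdjoin_induction (p := fun x => Continuous fun t => f t x)
    hf ?_ ?_ ?_ ?_ ?_ ?_ x
  · intro x y hx hy
    simp only [map_add]
    exact hx.add hy
  · simpa only [map_zero] using continuous_const
  · intro x y hx hy
    simp only [map_mul]
    exact hx.mul hy
  · intro c x hx
    simp only [map_smul]
    exact hx.const_smul c
  · intro x hx
    simpa only [character_starAdjoin_star] using hx.star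
  · refine isClosed_of_closure_subset fun x hx => ?_
    -- Contractivity gives |f t x - f t y| ≤ ‖x - y‖ for every `t` at once, so the approximation is
    -- uniform.
    refine continuous_of_uniform_approx_of_continuous fun u hu => ?_
    obtain ⟨ε, hε, hu⟩ := Metric.mem_uniformity_dist.1 hu
    obtain ⟨y, hy, hxy⟩ := Metric.mem_closure_iff.1 hx ε hε
    refine ⟨fun t => f t y, hy, fun t => hu ?_⟩
    rw [dist_eq_norm, ← map_sub]
    exact (norm_character_apply_le (f t) (x - y)).trans_lt (by rwa [← dist_eq_norm])

/-- If an algebra `A` maps onto a generating set of a C*-algebra and every character of `A`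
extends, then restriction is a homeomorphism of the maximal ideal spaces. -/
theorem nonempty_homeomorph_characterSpace {A : Type*} [NonUnitalNonAssocSemiring A]
    [TopologicalSpace A] [Module ℂ A] (j : A →ₙₐ[ℂ] B) (hj : Continuous j)
    (hjS : ∀ a, j a ∈ (NonUnitalStarAlgebra.adjoin ℂ G).topologicalClosure)
    (hG : G ⊆ Set.range j)
    (hext : ∀ φ : characterSpace ℂ A, ∃ Ψ : B →ₙₐ[ℂ] ℂ, Continuous Ψ ∧ ∀ a, Ψ (j a) = φ a) :
    Nonempty (characterSpace ℂ (NonUnitalStarAlgebra.adjoin ℂ G).topologicalClosure ≃ₜ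
      characterSpace ℂ A) := by
  set S := (NonUnitalStarAlgebra.adjoin ℂ G).topologicalClosure with hS
  have hrestrict : ∀ ψ : characterSpace ℂ S, ∃ φ : characterSpace ℂ A,
      ∀ a, φ a = ψ ⟨j a, hjS a⟩ := by
    intro ψ
    obtain ⟨x, hx, hne⟩ := exists_mem_character_ne_zero ψ
    obtain ⟨a, ha⟩ := hG hx
    have hxa : x = ⟨j a, hjS a⟩ := Subtype.ext ha.symm
    refine ⟨characterOf ((CharacterSpace.toNonUnitalAlgHom ψ).comp
      (show A →ₙₐ[ℂ] S from NonUnitalAlgHom.codRestrict j S.toNonUnitalSubalgebra hjS)) ?_ a ?_, fun a => rfl⟩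
    · exact (map_continuous ψ).comp (hj.subtype_mk hjS)
    · rw [hxa] at hne
      exact hne
  have hextend : ∀ φ : characterSpace ℂ A, ∃ ψ : characterSpace ℂ S,
      ∀ a, ψ ⟨j a, hjS a⟩ = φ a := by
    intro φ
    obtain ⟨Ψ, hΨ, h⟩ := hext φ
    obtain ⟨a, ha⟩ := exists_character_ne_zero φ
    refine ⟨characterOf (Ψ.comp (NonUnitalSubalgebraClass.subtype S)) ?_ ⟨j a, hjS a⟩ ?_, h⟩
    · exact hΨ.comp continuous_subtype_val
    · exact (h a).trans_ne ha
  choose R hR using hrestrict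
  choose E hE using hextend
  have hgen : ∀ x : S, (x : B) ∈ G → ∃ a, x = ⟨j a, hjS a⟩ := fun x hx => by
    obtain ⟨a, ha⟩ := hG hx
    exact ⟨a, Subtype.ext ha.symm⟩
  refine ⟨⟨⟨R, E, fun ψ => ?_, fun φ => ?_⟩, ?_, ?_⟩⟩
  · refine character_starAdjoin_ext fun x hx => ?_
    obtain ⟨a, rfl⟩ := hgen x hx
    rw [hE, hR]
  · refine CharacterSpace.ext fun a => ?_
    rw [hR, hE]
  · refine continuous_into_characterSpace fun a => ?_
    simpa only [hR] using continuous_character_apply (⟨j a, hjS a⟩ : S)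
  · refine continuous_into_characterSpace_starAdjoin fun x hx => ?_
    obtain ⟨a, rfl⟩ := hgen x hx
    simpa only [hE] using continuous_character_apply a

end Generators

/-! ### Coordinates of bounded families -/

namespace BoundedFamily

variable {ι : Type*} {K : ι → Type*} [∀ i, NormedAddCommGroup (K i)]
  [∀ i, InnerProductSpace ℂ (K i)]

@[ext]
theorem ext {x y : BoundedFamily K} (h : ∀ i, x.1 i = y.1 i) : x = y :=
  Subtype.ext (funext h)

variable [∀ i, CompleteSpace (K i)]

theorem norm_coord_le (x : BoundedFamily K) (i : ι) : ‖x.1 i‖ ≤ ‖x‖ :=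
  lp.norm_apply_le_norm (E := fun i => K i →L[ℂ] K i) ENNReal.top_ne_zero x i

theorem norm_mk_le {T : ∀ i, K i →L[ℂ] K i} {C : ℝ} (hT : ∀ i, ‖T i‖ ≤ C) (hC : 0 ≤ C) :
    ‖BoundedFamily.mk T C hT‖ ≤ C :=
  lp.norm_le_of_forall_le (E := fun i => K i →L[ℂ] K i) hC hT

/-- The functional `x ↦ ⟪e, x i e⟫`, multiplicative if `e` is a unit vector spanning `K i`. -/
def coordCharacter (i : ι) (e : K i) (he : ‖e‖ = 1) (hspan : ∀ y : K i, ∃ c : ℂ, y = c • e) :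
    BoundedFamily K →ₙₐ[ℂ] ℂ where
  toFun x := inner ℂ e (x.1 i e)
  map_smul' c x := by
    change inner ℂ e (c • x.1 i e) = c * inner ℂ e (x.1 i e)
    rw [inner_smul_right]
  map_zero' := by
    change inner ℂ e (0 : K i) = 0
    rw [inner_zero_right]
  map_add' x y := by
    change inner ℂ e (x.1 i e + y.1 i e) = _
    rw [inner_add_right]
  map_mul' x y := by
    change inner ℂ e (x.1 i (y.1 i e)) = _
    -- On a line, `e` is an eigenvector of every operator, so the eigenvalues multiply.
    obtain ⟨c, hc⟩ := hspan (y.1 i e)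
    rw [hc, map_smul, inner_smul_right, inner_smul_right, inner_self_eq_norm_sq_to_K, he]
    simp [mul_comm]

theorem continuous_coordCharacter (i : ι) (e : K i) (he : ‖e‖ = 1)
    (hspan : ∀ y : K i, ∃ c : ℂ, y = c • e) : Continuous (coordCharacter i e he hspan) := by
  refine AddMonoidHomClass.continuous_of_bound (coordCharacter i e he hspan) 1 fun x => ?_
  calc ‖(inner ℂ e (x.1 i e) : ℂ)‖ ≤ ‖e‖ * ‖x.1 i e‖ := norm_inner_le_norm _ _
    _ ≤ ‖e‖ * (‖x.1 i‖ * ‖e‖) := by gcongr; exact (x.1 i).le_opNorm e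
    _ ≤ 1 * ‖x‖ := by
      rw [he, one_mul, one_mul, mul_one]
      exact norm_coord_le x i

theorem coordCharacter_of_scalar (i : ι) (e : K i) (he : ‖e‖ = 1)
    (hspan : ∀ y : K i, ∃ c : ℂ, y = c • e) {x : BoundedFamily K} {c : ℂ}
    (hx : x.1 i = c • 1) : coordCharacter i e he hspan x = c := by
  change inner ℂ e (x.1 i e) = c
  rw [hx, smul_apply, one_apply_eq_self, inner_smul_right,
    inner_self_eq_norm_sq_to_K, he]
  simp

end BoundedFamily

/-! ### One-dimensional representations -/

/-- The one-dimensional Hilbert space in a given universe. -/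
abbrev HilbertLine : Type u := EuclideanSpace ℂ PUnit.{u + 1}

/-- The unit vector of the one-dimensional Hilbert space. -/
def HilbertLine.unit : HilbertLine.{u} := EuclideanSpace.single PUnit.unit 1

theorem HilbertLine.norm_unit : ‖HilbertLine.unit.{u}‖ = 1 := by
  simp [HilbertLine.unit]

theorem HilbertLine.eq_smul_unit (y : HilbertLine.{u}) : ∃ c : ℂ, y = c • HilbertLine.unit :=
  ⟨y PUnit.unit, by ext; simp [HilbertLine.unit]⟩

/-! ### Operator algebras: characters as completely contractive representations -/

section CompletelyContractive

variable {H : Type u} [NormedAddCommGroup H] [InnerProductSpace ℂ H]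

/-- The norm of `∑ w̄ᵢ zⱼ Tᵢⱼ` is at most `‖T‖ ‖z‖ ‖w‖`. -/
theorem norm_sum_smul_matrix_le {n : ℕ} (T : Matrix (Fin n) (Fin n) (H →L[ℂ] H))
    (w z : EuclideanSpace ℂ (Fin n)) :
    ‖∑ i, ∑ j, (star (w i) * z j) • T i j‖ ≤ ‖w‖ * (‖matrixOp T‖ * ‖z‖) := by
  refine ContinuousLinearMap.opNorm_le_bound _ (by positivity) fun x => ?_
  -- `ζ` is the elementary tensor z ⊗ x. Pairing its image under T with `w` gives the value at `x`,
  -- so Cauchy–Schwarz applies.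
  set ζ : PiLp 2 (fun _ : Fin n => H) := WithLp.toLp 2 fun j => z j • x with hζ
  have hζn : ‖ζ‖ = ‖z‖ * ‖x‖ := by
    rw [PiLp.norm_eq_of_L2, EuclideanSpace.norm_eq]
    simp only [hζ, norm_smul, mul_pow]
    rw [← Finset.sum_mul, Real.sqrt_mul (by positivity), Real.sqrt_sq (norm_nonneg x)]
  have hsum : (∑ i, ∑ j, (star (w i) * z j) • T i j) x = ∑ i, star (w i) • matrixOp T ζ i := by
    simp [matrixOp_apply, hζ, Finset.smul_sum, mul_smul]
  calc ‖(∑ i, ∑ j, (star (w i) * z j) • T i j) x‖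
      ≤ ∑ i, ‖w i‖ * ‖matrixOp T ζ i‖ := by
        rw [hsum]
        refine (norm_sum_le _ _).trans_eq ?_
        simp [norm_smul]
    _ ≤ √(∑ i, ‖w i‖ ^ 2) * √(∑ i, ‖matrixOp T ζ i‖ ^ 2) := Real.sum_mul_le_sqrt_mul_sqrt _ _ _
    _ = ‖w‖ * ‖matrixOp T ζ‖ := by
        rw [PiLp.norm_eq_of_L2 (matrixOp T ζ), EuclideanSpace.norm_eq]
    _ ≤ ‖w‖ * (‖matrixOp T‖ * ‖ζ‖) := by gcongr; exact (matrixOp T).le_opNorm ζ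
    _ = ‖w‖ * (‖matrixOp T‖ * ‖z‖) * ‖x‖ := by rw [hζn]; ring

/-- The one-dimensional representation given by a multiplicative functional. -/
def scalarRep {A : Type*} [NonUnitalNonAssocSemiring A] [Module ℂ A] (f : A →ₙₐ[ℂ] ℂ)
    (K : Type*) [NormedAddCommGroup K] [InnerProductSpace ℂ K] : A →ₙₐ[ℂ] (K →L[ℂ] K) where
  toFun a := f a • 1
  map_smul' c a := by simp [mul_smul]
  map_zero' := by simp
  map_add' a b := by simp [add_smul]
  map_mul' a b := by simp [smul_smul, mul_comm]

/-- Characters of operator algebras are completely contractive. -/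
theorem completelyContractive_scalarRep {A : NonUnitalSubalgebra ℂ (H →L[ℂ] H)}
    (φ : characterSpace ℂ A) :
    CompletelyContractive (scalarRep (CharacterSpace.toNonUnitalAlgHom φ) HilbertLine.{u}) := by
  intro n M
  refine ContinuousLinearMap.opNorm_le_bound _
    (norm_nonneg (matrixOp (M.map fun a => (a : H →L[ℂ] H)))) fun ξ => ?_
  set η := matrixOp (M.map fun a =>
    scalarRep (CharacterSpace.toNonUnitalAlgHom φ) HilbertLine.{u} a) ξ with hη
  set z : EuclideanSpace ℂ (Fin n) := WithLp.toLp 2 fun j => ξ j PUnit.unit with hz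
  set w : EuclideanSpace ℂ (Fin n) := WithLp.toLp 2 fun j => η j PUnit.unit with hw
  have hzn : ‖ξ‖ = ‖z‖ := by
    simp [PiLp.norm_eq_of_L2, hz]
  have hwn : ‖η‖ = ‖w‖ := by
    simp [PiLp.norm_eq_of_L2, hw]
  have hwi : ∀ i, w i = ∑ j, φ (M i j) * z j := by
    intro i
    simp [hw, hη, hz, matrixOp_apply, scalarRep]
  -- The compression b = w* M z lies in `A`, and w = φₙ(M) z gives φ(b) = w* w = ‖w‖². Plain
  -- contractivity of φ then yields ‖w‖² ≤ ‖b‖ ≤ ‖w‖ ‖M‖ ‖z‖.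
  set b : A := ∑ i, ∑ j, (star (w i) * z j) • M i j with hb
  have hφb : φ b = ((‖w‖ ^ 2 : ℝ) : ℂ) := by
    calc φ b = ∑ i, star (w i) * w i := by
          simp only [hb, map_sum, map_smul, smul_eq_mul]
          refine Finset.sum_congr rfl fun i _ => ?_
          rw [hwi i, Finset.mul_sum]
          exact Finset.sum_congr rfl fun j _ => by ring
      _ = ((‖w‖ ^ 2 : ℝ) : ℂ) := by
          rw [EuclideanSpace.norm_sq_eq]
          push_cast
          exact Finset.sum_congr rfl fun i _ => RCLike.conj_mul (w i)
  have hbn : ‖b‖ ≤ ‖w‖ * (‖matrixOp (M.map fun a => (a : H →L[ℂ] H))‖ * ‖z‖) := by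
    have := norm_sum_smul_matrix_le (M.map fun a => (a : H →L[ℂ] H)) w z
    have hbc : (b : H →L[ℂ] H) = ∑ i, ∑ j, (star (w i) * z j) • (M i j : H →L[ℂ] H) := by
      simp [hb]
    change ‖(b : H →L[ℂ] H)‖ ≤ _
    rwa [hbc]
  have hsq : ‖w‖ * ‖w‖ ≤ ‖w‖ * (‖matrixOp (M.map fun a => (a : H →L[ℂ] H))‖ * ‖z‖) := by
    refine le_trans ?_ ((norm_character_subalgebra_apply_le φ b).trans hbn)
    rw [hφb, Complex.norm_real, Real.norm_of_nonneg (by positivity), sq]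
  rw [hwn, hzn]
  rcases (norm_nonneg w).eq_or_lt with h0 | hpos
  · rw [← h0]
    positivity
  · exact le_of_mul_le_mul_left hsq hpos

/-- The homomorphism underlying the direct sum of all completely contractive representations. -/
def ccEmbeddingHom (A : NonUnitalSubalgebra ℂ (H →L[ℂ] H)) :
    A →ₙₐ[ℂ] BoundedFamily (CCRep.K (A := A)) where
  toFun := ccEmbedding A
  map_smul' c a := BoundedFamily.ext fun ρ => map_smul ρ.π c a
  map_zero' := BoundedFamily.ext fun ρ => map_zero ρ.π
  map_add' a b := BoundedFamily.ext fun ρ => map_add ρ.π a b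
  map_mul' a b := BoundedFamily.ext fun ρ => map_mul ρ.π a b

theorem continuous_ccEmbeddingHom (A : NonUnitalSubalgebra ℂ (H →L[ℂ] H)) :
    Continuous (ccEmbeddingHom A) :=
  AddMonoidHomClass.continuous_of_bound (ccEmbeddingHom A) 1 fun a => by
    rw [one_mul]
    exact BoundedFamily.norm_mk_le (fun ρ => ρ.completelyContractive.norm_le a) (norm_nonneg _)

/-- The completely contractive representation given by a character. -/
def CCRep.ofCharacter {A : NonUnitalSubalgebra ℂ (H →L[ℂ] H)} (φ : characterSpace ℂ A) :
    CCRep A where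
  K := HilbertLine.{u}
  π := scalarRep (CharacterSpace.toNonUnitalAlgHom φ) HilbertLine.{u}
  completelyContractive := completelyContractive_scalarRep φ

theorem nonempty_homeomorph_maximalCStar (A : NonUnitalSubalgebra ℂ (H →L[ℂ] H)) :
    Nonempty (MaximalIdealSpace (maximalCStar A) ≃ₜ MaximalIdealSpace A) := by
  refine nonempty_homeomorph_characterSpace (ccEmbeddingHom A) (continuous_ccEmbeddingHom A)
    (fun a => NonUnitalStarSubalgebra.le_topologicalClosure _
      (NonUnitalStarAlgebra.subset_adjoin ℂ _ ⟨a, rfl⟩)) subset_rfl fun φ => ?_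
  -- The extension reads off the coordinate indexed by the representation that φ itself defines.
  exact ⟨BoundedFamily.coordCharacter (CCRep.ofCharacter φ) HilbertLine.unit.{u}
    HilbertLine.norm_unit HilbertLine.eq_smul_unit,
    BoundedFamily.continuous_coordCharacter _ _ _ _,
    fun a => BoundedFamily.coordCharacter_of_scalar _ _ _ _ rfl⟩

end CompletelyContractive

/-! ### Graphs: characters as one-dimensional contractive representations -/

section Graph

variable {V : Type u} [Quiver.{v} V]

/-- A vertex as an element of the universal operator algebra. -/
def graphOA.vertex (a : V) : graphOA.{u, v} V :=
  ⟨vertexElement a, NonUnitalSubalgebra.le_topologicalClosure _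
    (NonUnitalAlgebra.subset_adjoin ℂ (Or.inl ⟨a, rfl⟩))⟩

/-- An edge as an element of the universal operator algebra. -/
def graphOA.edge {a b : V} (e : a ⟶ b) : graphOA.{u, v} V :=
  ⟨edgeElement e, NonUnitalSubalgebra.le_topologicalClosure _
    (NonUnitalAlgebra.subset_adjoin ℂ (Or.inr ⟨a, b, e, rfl⟩))⟩

theorem graphOA.vertex_mul_self (a : V) :
    graphOA.vertex.{u, v} a * graphOA.vertex a = graphOA.vertex a :=
  Subtype.ext (BoundedFamily.ext fun ρ => (ρ.isStarProjection a).isIdempotentElem)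

theorem graphOA.vertex_mul_edge {a b : V} (e : a ⟶ b) :
    graphOA.vertex.{u, v} b * graphOA.edge e = graphOA.edge e :=
  Subtype.ext (BoundedFamily.ext fun ρ => ρ.range_mul e)

theorem graphOA.edge_mul_vertex {a b : V} (e : a ⟶ b) :
    graphOA.edge.{u, v} e * graphOA.vertex a = graphOA.edge e :=
  Subtype.ext (BoundedFamily.ext fun ρ => ρ.mul_source e)

theorem graphOA.norm_edge_le {a b : V} (e : a ⟶ b) : ‖graphOA.edge.{u, v} e‖ ≤ 1 :=
  BoundedFamily.norm_mk_le (fun ρ => ρ.norm_le_one e) zero_le_one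

/-- The contractive representation of a graph given by a character of its operator algebra. -/
def GraphRep.ofCharacter (φ : characterSpace ℂ (graphOA.{u, v} V)) : GraphRep.{u, v} V where
  K := HilbertLine.{max u v}
  P a := φ (graphOA.vertex a) • 1
  T e := φ (graphOA.edge e) • 1
  isStarProjection a := by
    have h : φ (graphOA.vertex a) * φ (graphOA.vertex a) = φ (graphOA.vertex a) := by
      rw [← map_mul, graphOA.vertex_mul_self]
    -- An idempotent scalar is 0 or 1, so each vertex acts as a self-adjoint projection.
    rcases IsIdempotentElem.iff_eq_zero_or_one.1 h with h | h
    · rw [h, zero_smul]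
      exact .zero _
    · rw [h, one_smul]
      exact .one _
  norm_le_one e := by
    rw [norm_smul]
    refine mul_le_one₀ ?_ (norm_nonneg _) ContinuousLinearMap.norm_id_le
    exact (norm_character_subalgebra_apply_le φ _).trans (graphOA.norm_edge_le e)
  range_mul e := by
    rw [smul_mul_smul_comm, one_mul, ← map_mul, graphOA.vertex_mul_edge]
  mul_source e := by
    rw [smul_mul_smul_comm, one_mul, ← map_mul, graphOA.edge_mul_vertex]

theorem graphOA_le_graphCStar {x : GraphProduct.{u, v} V} (hx : x ∈ graphOA.{u, v} V) :
    x ∈ graphCStar.{u, v} V := by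
  refine closure_mono ?_ hx
  exact NonUnitalAlgebra.adjoin_le
    (S := (NonUnitalStarAlgebra.adjoin ℂ (graphGenerators.{u, v} V)).toNonUnitalSubalgebra)
    (NonUnitalStarAlgebra.subset_adjoin ℂ _)

theorem nonempty_homeomorph_graphCStar (V : Type u) [Quiver.{v} V] :
    Nonempty (MaximalIdealSpace (graphCStar.{u, v} V) ≃ₜ
      MaximalIdealSpace (graphOA.{u, v} V)) := by
  refine nonempty_homeomorph_characterSpace
    (NonUnitalSubalgebraClass.subtype (graphOA.{u, v} V)) continuous_subtype_val
    (fun a => graphOA_le_graphCStar a.2) ?_ fun φ => ?_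
  · intro x hx
    exact ⟨⟨x, NonUnitalSubalgebra.le_topologicalClosure _
      (NonUnitalAlgebra.subset_adjoin ℂ hx)⟩, rfl⟩
  · set Ψ := BoundedFamily.coordCharacter
      (K := (GraphRep.K : GraphRep.{u, v} V → Type (max u v)))
      (GraphRep.ofCharacter φ) HilbertLine.unit.{max u v}
      HilbertLine.norm_unit HilbertLine.eq_smul_unit with hΨdef
    have hΨ : Continuous Ψ := BoundedFamily.continuous_coordCharacter _ _ _ _
    refine ⟨Ψ, hΨ, fun x => ?_⟩
    -- `Ψ` agrees with φ on vertices and edges by construction; both are continuous and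
    -- multiplicative, so they agree on the closed algebra these generate.
    refine closure_adjoin_induction (G := graphGenerators.{u, v} V)
      (p := fun x => Ψ (x : GraphProduct.{u, v} V) = φ x) ?_ ?_ ?_ ?_ ?_ ?_ x
    · rintro ⟨x, hx⟩ (⟨a, rfl⟩ | ⟨a, b, e, rfl⟩)
      · exact BoundedFamily.coordCharacter_of_scalar _ _ _ _ rfl
      · exact BoundedFamily.coordCharacter_of_scalar _ _ _ _ rfl
    · intro x y hx hy
      exact (map_add Ψ _ _).trans ((congrArg₂ _ hx hy).trans (map_add φ _ _).symm)
    · exact (map_zero Ψ).trans (map_zero φ).symm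
    · intro x y hx hy
      exact (map_mul Ψ _ _).trans ((congrArg₂ _ hx hy).trans (map_mul φ _ _).symm)
    · intro c x hx
      exact (map_smul Ψ _ _).trans ((congrArg _ hx).trans (map_smul φ _ _).symm)
    · exact isClosed_eq (hΨ.comp continuous_subtype_val) (map_continuous φ)

end Graph

end

theorem proposition8 :
    (∀ (H : Type u) [NormedAddCommGroup H] [InnerProductSpace ℂ H] [CompleteSpace H]
      (A : NonUnitalSubalgebra ℂ (H →L[ℂ] H)), IsClosed (A : Set (H →L[ℂ] H)) →
      Nonempty (MaximalIdealSpace (maximalCStar A) ≃ₜ MaximalIdealSpace A)) ∧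
    (∀ (V : Type u) [Quiver.{v} V],
      Nonempty (MaximalIdealSpace (graphCStar V) ≃ₜ MaximalIdealSpace (graphOA V))) := by
  exact ⟨fun H _ _ _ A _ => nonempty_homeomorph_maximalCStar A,
    fun V _ => nonempty_homeomorph_graphCStar V⟩
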